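/- **Setting.** Let $\mathcal{K}$ be an $\infty$-category (a quasicategory). A morphism $A\to B$ is an edge of $\mathcal K$ from $A$ to $B$, i.e. a vertex of the mapping Kan complex $\mathcal{K}(A,B)$; $f\simeq g$ means that $f,g\in\mathcal K(A,B)$ are homotopic, and composites $g\circ f$ are taken up to homotopy. Say that $\mathcal{K}$ is a *$(0,\infty)$-category* if 1. every $\mathcal{K}(A,B)$ is a complete homotopy partial order with a least element: its morphisms carry a reflexive and transitive relation $\precsim$ such that $f\simeq g$ if and only if $f\precsim g$ and $g\precsim f$; every chain $f_0\precsim f_1\precsim\cdots$ has a supremum; and there is $0_{A,B}\in\mathcal{K}(A,B)$ with $0_{A,B}\precsim f$ for all $f\in\mathcal{K}(A,B)$; 2. composition is continuous for the homotopy order: if $f_0\precsim f_1\precsim\cdots$ in $\mathcal{K}(A,B)$ has supremum $f$ and $g_0\precsim g_1\precsim\cdots$ in $\mathcal{K}(B,C)$ has supremum $g$, then $g\circ f$ is a supremum of $(g_i\circ f_i)_{i}$; 3. $0_{B,C}\circ f\simeq 0_{A,C}$ for every $f\in\mathcal{K}(A,B)$. A pair of morphisms $f^+:A\to B$, $f^-:B\to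 A$ in a $(0,\infty)$-category is an *h-projection pair* from $A$ to $B$ if $f^-\circ f^+\simeq I_A$ and $f^+\circ f^-\precsim I_B$. A functor of $\infty$-categories $F:\mathcal{K}^{op}\times\mathcal{K}\to\mathcal{K}$ is *locally h-monotonic* if for all $f,f'\in\mathcal{K}^{op}(A,A')=\mathcal{K}(A',A)$ and $g,g'\in\mathcal{K}(B,B')$, $f\precsim f'$ and $g\precsim g'$ imply $F(f,g)\precsim F(f',g')$ in $\mathcal{K}(F(A,B),F(A',B'))$, where $\mathcal{K}^{op}(A,A')$ carries the order of $\mathcal{K}(A',A)$. **Proposition.** Let $\mathcal{K}$ be a $(0,\infty)$-category and let $F:\mathcal{K}^{op}\times\mathcal{K}\to\mathcal{K}$ be a locally h-monotonic functor. If $(f^+,f^-)$ is an h-projection pair from $A$ to $B$ and $(g^+,g^-)$ is an h-projection pair from $C$ to $D$, then $$F^{+-}\big((f^+,f^-),(g^+,g^-)\big)=\big(F(f^-,g^+),\,F(f^+,g^-)\big)$$ is an h-projection pair from $F(A,C)$ to $F(B,D)$. -/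

import Mathlib

open CategoryTheory Simplicial MonoidalCategory

universe u

namespace HomotopyDomain

/-- `s` is a supremum of the sequence `c` for the relation `le`. -/
def IsSup {V : Type u} (le : V → V → Prop) (c : ℕ → V) (s : V) : Prop :=
  (∀ n, le (c n) s) ∧ ∀ t, (∀ n, le (c n) t) → le s t

/-- A homotopy partial order (h.p.o.) on the objects `V` of an infinity-category in which `equiv` is
the relation of equivalence between objects: a preorder containing equivalence which satisfies
the Cantor-Schroeder-Bernstein property. (The order `x ≾ y` means that there is an embedding of
`x` into `y`; equivalences are embeddings and embeddings compose.) -/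
structure HPO {V : Type u} (equiv : V → V → Prop) where
  /-- the homotopy order -/
  le : V → V → Prop
  le_of_equiv : ∀ {x y : V}, equiv x y → le x y
  le_trans : ∀ {x y z : V}, le x y → le y z → le x z
  equiv_of_le_of_le : ∀ {x y : V}, le x y → le y x → equiv x y

/-- A complete homotopy partial order (c.h.p.o.): an h.p.o. in which every chain
`x₀ ≾ x₁ ≾ x₂ ≾ ⋯` has a supremum. -/
structure CHPO {V : Type u} (equiv : V → V → Prop) extends HPO equiv where
  exists_sup : ∀ c : ℕ → V, (∀ n, le (c n) (c (n + 1))) → ∃ s, IsSup le c s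

section SimplicialSets

variable {K L : SSet.{u}}

/-- `h ≃ g ∘ f` : the edge `h` is a composite of `f : A → B` and `g : B → C`, that is, there is a
2-simplex with these faces. -/
def IsComp {A B C : K _⦋0⦌} (f : SSet.Edge A B) (g : SSet.Edge B C) (h : SSet.Edge A C) : Prop :=
  Nonempty (SSet.Edge.CompStruct f g h)

/-- Homotopy `f ≃ g` of morphisms `A → B`: there is a 2-simplex with faces `f`, `id_B` and `g`,
that is, a 1-simplex from `f` to `g` in the mapping Kan complex `K(A, B)`, whose vertices are
the edges from `A` to `B`. -/
def Homotopic {A B : K _⦋0⦌} (f g : SSet.Edge A B) : Prop :=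
  IsComp f (SSet.Edge.id B) g

/-- A vertex of `K`, seen as a vertex of the opposite simplicial set. -/
def opVertex (A : K _⦋0⦌) : K.op _⦋0⦌ := SSet.opObjEquiv.symm A

/-- A morphism `f : A → B` of `K`, seen as a morphism `B → A` of `K.op`. -/
def opEdge {A B : K _⦋0⦌} (f : SSet.Edge A B) : SSet.Edge (opVertex B) (opVertex A) :=
  SSet.Edge.mk (X := K.op) (SSet.opObjEquiv.symm f.edge)
    ((SSet.op_δ K 1 _).trans (congrArg SSet.opObjEquiv.symm f.tgt_eq))
    ((SSet.op_δ K 0 _).trans (congrArg SSet.opObjEquiv.symm f.src_eq))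

/-- The vertex `(A, B)` of a product. -/
def pairVertex (A : K _⦋0⦌) (B : L _⦋0⦌) : (K ⊗ L) _⦋0⦌ := (A, B)

/-- The morphism `(f, g) : (A, B) → (A', B')` of a product. -/
def pairEdge {A A' : K _⦋0⦌} {B B' : L _⦋0⦌} (f : SSet.Edge A A') (g : SSet.Edge B B') :
    SSet.Edge (pairVertex A B) (pairVertex A' B') :=
  SSet.Edge.mk (X := K ⊗ L) (f.edge, g.edge)
    (Prod.ext f.src_eq g.src_eq) (Prod.ext f.tgt_eq g.tgt_eq)

/-- The object `F(A, B)`, for a functor `F : K^op × K → K`. -/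
def objMap (F : K.op ⊗ K ⟶ K) (A B : K _⦋0⦌) : K _⦋0⦌ :=
  F.app _ (pairVertex (opVertex A) B)

/-- The morphism `F(f, g) : F(A, B) → F(A', B')`, for a functor `F : K^op × K → K` and morphisms
`f : A' → A` and `g : B → B'` of `K`. -/
def edgeMap (F : K.op ⊗ K ⟶ K) {A A' B B' : K _⦋0⦌} (f : SSet.Edge A' A) (g : SSet.Edge B B') :
    SSet.Edge (objMap F A B) (objMap F A' B') :=
  (pairEdge (opEdge f) g).map F

end SimplicialSets

/-- A `(0, ∞)`-category: an infinity-category (quasicategory) `K` such that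
every mapping Kan complex `K(A, B)` is a c.h.p.o. with a least element `0_{A,B}`, composition is
continuous for the homotopy order, and `0_{B,C} ∘ f ≃ 0_{A,C}` for every `f : A → B`. -/
class ZeroInftyCategory (K : SSet.{u}) extends SSet.Quasicategory K where
  hom : ∀ A B : K _⦋0⦌, CHPO (Homotopic (K := K) (A := A) (B := B))
  zero : ∀ A B : K _⦋0⦌, SSet.Edge A B
  zero_le : ∀ {A B : K _⦋0⦌} (f : SSet.Edge A B), (hom A B).le (zero A B) f
  /-- Composition preserves suprema of chains (in particular, it is monotone). -/
  comp_continuous : ∀ {A B C : K _⦋0⦌}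
    (f : ℕ → SSet.Edge A B) (g : ℕ → SSet.Edge B C) (h : ℕ → SSet.Edge A C)
    (f' : SSet.Edge A B) (g' : SSet.Edge B C) (h' : SSet.Edge A C),
    (∀ n, (hom A B).le (f n) (f (n + 1))) → (∀ n, (hom B C).le (g n) (g (n + 1))) →
    IsSup (hom A B).le f f' → IsSup (hom B C).le g g' →
    (∀ n, IsComp (f n) (g n) (h n)) → IsComp f' g' h' → IsSup (hom A C).le h h'
  zero_comp : ∀ {A B C : K _⦋0⦌} (f : SSet.Edge A B), IsComp f (zero B C) (zero A C)

section

variable {K : SSet.{u}} [ZeroInftyCategory K]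

/-- The homotopy order `f ≾ g` on the morphisms `A → B` of a `(0, ∞)`-category. -/
def HLe {A B : K _⦋0⦌} (f g : SSet.Edge A B) : Prop :=
  (ZeroInftyCategory.hom A B).le f g

/-- `(f⁺, f⁻)` is an h-projection pair from `A` to `B`: `f⁺ : A → B` and `f⁻ : B → A` satisfy
`f⁻ ∘ f⁺ ≃ id_A` and `f⁺ ∘ f⁻ ≾ id_B`. -/
def IsHProjectionPair {A B : K _⦋0⦌} (p : SSet.Edge A B × SSet.Edge B A) : Prop :=
  (∃ r, IsComp p.1 p.2 r ∧ Homotopic r (SSet.Edge.id A)) ∧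
    ∃ e, IsComp p.2 p.1 e ∧ HLe e (SSet.Edge.id B)

/-- A functor `F : K^op × K → K` is locally h-monotonic if `f ≾ f'` and `g ≾ g'` imply
`F(f, g) ≾ F(f', g')`; the order on `K^op(A, A') = K(A', A)` is that of `K(A', A)`. -/
def LocallyHMonotonic (F : K.op ⊗ K ⟶ K) : Prop :=
  ∀ {A A' B B' : K _⦋0⦌} (f f' : SSet.Edge A' A) (g g' : SSet.Edge B B'),
    HLe f f' → HLe g g' → HLe (edgeMap F f g) (edgeMap F f' g')

/-- `F^{+-}((f⁺, f⁻), (g⁺, g⁻)) = (F(f⁻, g⁺), F(f⁺, g⁻))`. -/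
def plusMinus (F : K.op ⊗ K ⟶ K) {A B C D : K _⦋0⦌}
    (f : SSet.Edge A B × SSet.Edge B A) (g : SSet.Edge C D × SSet.Edge D C) :
    SSet.Edge (objMap F A C) (objMap F B D) × SSet.Edge (objMap F B D) (objMap F A C) :=
  (edgeMap F f.2 g.1, edgeMap F f.1 g.2)

end

end HomotopyDomain

namespace HomotopyDomain

section SimplicialSets

variable {K L : SSet.{u}}

/-! A simplicial map carries 2-simplices to 2-simplices and degenerate edges to degenerate edges, so
`F` respects composites (`IsComp.edgeMap`) and identities (`edgeMap_id`). Contravariance in the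
first slot makes `F(f⁻ ∘ f⁺, g⁻ ∘ g⁺)` a composite of the new pair in one order, and `F(f⁺ ∘ f⁻, g⁺
∘ g⁻)` in the other. Local monotonicity compares the second with `F(id, id) = id`. For the first,
homotopy amounts to `≾` in both directions, so monotonicity applied twice suffices; this needs
symmetry of homotopy, which comes from horn filling. -/

/-- Filling of a horn `Λ[3, 1]` in a quasicategory, in terms of 2-simplices with given edges. -/
lemma nonempty_compStruct_of_horn₃₁ [SSet.Quasicategory K] {x₀ x₁ x₂ x₃ : K _⦋0⦌}
    {e₀₁ : SSet.Edge x₀ x₁} {e₁₂ : SSet.Edge x₁ x₂} {e₂₃ : SSet.Edge x₂ x₃}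
    {e₀₂ : SSet.Edge x₀ x₂} {e₁₃ : SSet.Edge x₁ x₃} {e₀₃ : SSet.Edge x₀ x₃}
    (f₃ : SSet.Edge.CompStruct e₀₁ e₁₂ e₀₂) (f₀ : SSet.Edge.CompStruct e₁₂ e₂₃ e₁₃)
    (f₂ : SSet.Edge.CompStruct e₀₁ e₁₃ e₀₃) :
    Nonempty (SSet.Edge.CompStruct e₀₂ e₂₃ e₀₃) := by
  obtain ⟨φ, h₀, h₂, h₃⟩ := SSet.horn₃₁.exists_desc
    (SSet.yonedaEquiv.symm f₀.simplex) (SSet.yonedaEquiv.symm f₂.simplex)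
    (SSet.yonedaEquiv.symm f₃.simplex)
    (by simp [SSet.stdSimplex.δ_comp_yonedaEquiv_symm])
    (by simp [SSet.stdSimplex.δ_comp_yonedaEquiv_symm])
    (by simp [SSet.stdSimplex.δ_comp_yonedaEquiv_symm])
  obtain ⟨τ, hτ⟩ := SSet.Quasicategory.hornFilling (n := 3) (i := 1) (by decide) (by decide) φ
  obtain ⟨t, rfl⟩ := SSet.yonedaEquiv.symm.surjective τ
  have face (j : Fin 4) (hj : j ≠ 1) (s : K _⦋2⦌)
      (hs : SSet.horn.ι 1 j hj ≫ φ = SSet.yonedaEquiv.symm s) : K.δ j t = s := by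
    rw [hτ, SSet.horn.ι_ι_assoc, SSet.stdSimplex.δ_comp_yonedaEquiv_symm] at hs
    exact SSet.yonedaEquiv.symm.injective hs
  have t₀ := face 0 (by decide) _ h₀
  have t₂ := face 2 (by decide) _ h₂
  have t₃ := face 3 (by decide) _ h₃
  -- The face missing from the horn is the wanted 2-simplex; each of its edges is shared with one of
  -- the three given faces.
  refine ⟨.mk (K.δ 1 t) ?_ ?_ ?_⟩
  · rw [← f₃.d₁, ← t₃]
    exact (ConcreteCategory.congr_hom
      (SimplicialObject.δ_comp_δ K (i := 1) (j := 2) (by decide)) t).symm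
  · rw [← f₀.d₀, ← t₀]
    exact (ConcreteCategory.congr_hom
      (SimplicialObject.δ_comp_δ K (i := 0) (j := 0) (by decide)) t)
  · rw [← f₂.d₁, ← t₂]
    exact (ConcreteCategory.congr_hom
      (SimplicialObject.δ_comp_δ K (i := 1) (j := 1) (by decide)) t).symm

/-- Fill the horn on vertices `A, B, B, B` whose spine is `f, id, id`: its faces are the given
homotopy and two degenerate simplices, and the new face is the reversed homotopy. -/
lemma Homotopic.symm [SSet.Quasicategory K] {A B : K _⦋0⦌} {f g : SSet.Edge A B}
    (h : Homotopic f g) : Homotopic g f :=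
  h.elim fun h ↦ nonempty_compStruct_of_horn₃₁ h (.idComp _) (.compId f)

/-- Passing to the opposite reverses the vertices of a simplex, so faces 0 and 2 trade places. -/
lemma IsComp.opEdge {A B C : K _⦋0⦌} {f : SSet.Edge A B} {g : SSet.Edge B C}
    {h : SSet.Edge A C} (w : IsComp f g h) :
    IsComp (opEdge g) (opEdge f) (opEdge h) := by
  obtain ⟨s⟩ := w
  exact ⟨.mk (SSet.opObjEquiv.symm s.simplex)
    ((SSet.op_δ K 2 _).trans (congrArg SSet.opObjEquiv.symm s.d₀))
    ((SSet.op_δ K 0 _).trans (congrArg SSet.opObjEquiv.symm s.d₂))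
    ((SSet.op_δ K 1 _).trans (congrArg SSet.opObjEquiv.symm s.d₁))⟩

lemma IsComp.pairEdge {A A' A'' : K _⦋0⦌} {B B' B'' : L _⦋0⦌}
    {f : SSet.Edge A A'} {f' : SSet.Edge A' A''} {f'' : SSet.Edge A A''}
    {g : SSet.Edge B B'} {g' : SSet.Edge B' B''} {g'' : SSet.Edge B B''}
    (w : IsComp f f' f'') (w' : IsComp g g' g'') :
    IsComp (pairEdge f g) (pairEdge f' g') (pairEdge f'' g'') := by
  obtain ⟨s⟩ := w
  obtain ⟨s'⟩ := w'
  exact ⟨.mk (X := K ⊗ L) (s.simplex, s'.simplex)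
    (Prod.ext s.d₂ s'.d₂) (Prod.ext s.d₀ s'.d₀) (Prod.ext s.d₁ s'.d₁)⟩

/-- Functors `K^op × K → K` preserve composition. -/
lemma IsComp.edgeMap (F : K.op ⊗ K ⟶ K) {A A' A'' B B' B'' : K _⦋0⦌}
    {f : SSet.Edge A' A} {f' : SSet.Edge A'' A'} {f'' : SSet.Edge A'' A}
    {g : SSet.Edge B B'} {g' : SSet.Edge B' B''} {g'' : SSet.Edge B B''}
    (w : IsComp f' f f'') (w' : IsComp g g' g'') :
    IsComp (edgeMap F f g) (edgeMap F f' g') (edgeMap F f'' g'') :=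
  (w.opEdge.pairEdge w').elim fun s ↦ ⟨s.map F⟩

/-- Functors `K^op × K → K` preserve identities. -/
lemma edgeMap_id (F : K.op ⊗ K ⟶ K) (A B : K _⦋0⦌) :
    edgeMap F (SSet.Edge.id A) (SSet.Edge.id B) = SSet.Edge.id (objMap F A B) := by
  have h : pairEdge (opEdge (SSet.Edge.id A)) (SSet.Edge.id B) =
      SSet.Edge.id (pairVertex (opVertex A) B) :=
    SSet.Edge.ext (Prod.ext (SSet.op_σ K 0 (opVertex A)).symm rfl)
  exact (congrArg (fun e ↦ e.map F) h).trans (SSet.Edge.map_id _ F)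

end SimplicialSets

variable {K : SSet.{u}} [ZeroInftyCategory K]

lemma Homotopic.hLe {A B : K _⦋0⦌} {f g : SSet.Edge A B} (h : Homotopic f g) : HLe f g :=
  (ZeroInftyCategory.hom A B).le_of_equiv h

/-- A locally h-monotonic functor preserves homotopy of morphisms. -/
lemma LocallyHMonotonic.homotopic_edgeMap {F : K.op ⊗ K ⟶ K} (hF : LocallyHMonotonic F)
    {A A' B B' : K _⦋0⦌} {f f' : SSet.Edge A' A} {g g' : SSet.Edge B B'}
    (hf : Homotopic f f') (hg : Homotopic g g') :
    Homotopic (edgeMap F f g) (edgeMap F f' g') :=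
  -- Mapping the 2-simplices directly would not do: in `K.op` the identity edge of a homotopy moves
  -- to the other side. The order avoids comparing left and right homotopies.
  (ZeroInftyCategory.hom _ _).equiv_of_le_of_le (hF _ _ _ _ hf.hLe hg.hLe)
    (hF _ _ _ _ hf.symm.hLe hg.symm.hLe)

end HomotopyDomain

theorem proposition2p1 {K : SSet.{u}} [HomotopyDomain.ZeroInftyCategory K]
    (F : K.op ⊗ K ⟶ K) (hF : HomotopyDomain.LocallyHMonotonic F)
    {A B C D : K _⦋0⦌}
    (f : SSet.Edge A B × SSet.Edge B A) (g : SSet.Edge C D × SSet.Edge D C)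
    (hf : HomotopyDomain.IsHProjectionPair f) (hg : HomotopyDomain.IsHProjectionPair g) :
    HomotopyDomain.IsHProjectionPair (HomotopyDomain.plusMinus F f g) := by
  obtain ⟨⟨r, hr, hr'⟩, e, he, he'⟩ := hf
  obtain ⟨⟨s, hs, hs'⟩, d, hd, hd'⟩ := hg
  refine ⟨⟨HomotopyDomain.edgeMap F r s, hr.edgeMap F hs, ?_⟩,
    HomotopyDomain.edgeMap F e d, he.edgeMap F hd, ?_⟩
  · rw [← HomotopyDomain.edgeMap_id]
    exact hF.homotopic_edgeMap hr' hs'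
  · rw [← HomotopyDomain.edgeMap_id]
    exact hF _ _ _ _ he' hd'
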